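/- Let $k\ge 1$. The jet space $J^k(\mathbb R)$ is $\mathbb R^{k+2}$, with points $(x,u_k,\dots,u_0)$, equipped with the group law $(x,u_k,\dots,u_0)\odot(y,v_k,\dots,v_0)=(x+y,w_k,\dots,w_0)$, where $w_s=u_s+v_s+\sum_{j=s+1}^k u_j\frac{y^{j-s}}{(j-s)!}$ for $0\le s\le k$. A horizontal curve is an absolutely continuous curve in $\mathbb R^{k+2}$ whose velocity is annihilated almost everywhere by the contact forms $du_j-u_{j+1}\,dx$, $0\le j<k$; its length is $\int\sqrt{(x')^2+(u_k')^2}$, and the Carnot–Carathéodory distance of two points is the infimum of the lengths of the horizontal curves that join them. Hausdorff dimension $\dim_H$ in $J^k(\mathbb R)$ is taken with respect to this distance. For a smooth function $f:\mathbb R\to\mathbb R$ put $j^k_x(f)=(x,f^{(k)}(x),\dots,f'(x),f(x))$, and for $t\in\mathbb R$ define the vertical mapping $V_{f,t}:J^k(\mathbb R)\to J^k(\mathbb R)$ by $V_{f,t}(p)=p\odot j^k_{x-t}(f)^{-1}$ for $p=(x,u_k,\dots,u_0)$. Proposition. Let $f(x)=mx+b$ with $m\ne 0$, and let $0\le\mu\le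 1$. There is a Borel set $E\subset J^k(\mathbb R)$, independent of $t$, such that $\dim_H E=\mu$ and, for all $t\in\mathbb R$, $\dim_H V_{f,t}(E)=(k+1)\mu$. -/

import Mathlib

open MeasureTheory Set
open scoped ENNReal Nat

/-- The jet space `J^k(ℝ) = ℝ^{k+2}`, with points `(x, u_k, …, u_0)`; `u j` is the coordinate
`u_j`. -/
@[ext]
structure JetSpace (k : ℕ) where
  x : ℝ
  u : Fin (k + 1) → ℝ

namespace JetSpace

variable {k : ℕ}

/-! ### The group law -/

/-- `(x, u) ⊙ (y, v) = (x + y, w)` with `w_s = u_s + v_s + ∑_{j > s} u_j y^{j-s} / (j-s)!`. -/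
noncomputable instance : Mul (JetSpace k) where
  mul p q :=
    ⟨p.x + q.x, fun s => p.u s + q.u s +
      ∑ j ∈ Finset.Ioi s, p.u j * (q.x ^ ((j : ℕ) - s) / ((j : ℕ) - s)!)⟩

instance : One (JetSpace k) where
  one := ⟨0, fun _ => 0⟩

noncomputable instance : Inv (JetSpace k) where
  inv p :=
    ⟨-p.x, fun s => -∑ j ∈ Finset.Ici s, p.u j * ((-p.x) ^ ((j : ℕ) - s) / ((j : ℕ) - s)!)⟩

/-- The Taylor shift on the coordinates `u`. -/
noncomputable def shift (y : ℝ) (u : Fin (k + 1) → ℝ) (s : Fin (k + 1)) : ℝ :=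
  ∑ j ∈ Finset.Ici s, u j * (y ^ ((j : ℕ) - s) / ((j : ℕ) - s)!)

theorem shift_eq (y : ℝ) (u : Fin (k + 1) → ℝ) (s : Fin (k + 1)) :
    shift y u s = u s + ∑ j ∈ Finset.Ioi s, u j * (y ^ ((j : ℕ) - s) / ((j : ℕ) - s)!) := by
  unfold shift
  rw [← Finset.Ioi_insert, Finset.sum_insert (by simp)]
  simp

theorem mul_x (p q : JetSpace k) : (p * q).x = p.x + q.x := rfl

theorem mul_u (p q : JetSpace k) (s : Fin (k + 1)) :
    (p * q).u s = shift q.x p.u s + q.u s := by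
  rw [shift_eq]
  change p.u s + q.u s + _ = _
  ring

theorem one_x : (1 : JetSpace k).x = 0 := rfl
theorem one_u (s : Fin (k + 1)) : (1 : JetSpace k).u s = 0 := rfl
theorem inv_x (p : JetSpace k) : (p⁻¹).x = -p.x := rfl
theorem inv_u (p : JetSpace k) (s : Fin (k + 1)) : (p⁻¹).u s = -shift (-p.x) p.u s := rfl

theorem sum_Icc_pow (y z : ℝ) {s j : Fin (k + 1)} (h : s ≤ j) :
    ∑ t ∈ Finset.Icc s j, (y ^ ((j : ℕ) - t) / ((j : ℕ) - t)!) * (z ^ ((t : ℕ) - s) / ((t : ℕ) - s)!)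
      = (y + z) ^ ((j : ℕ) - s) / ((j : ℕ) - s)! := by
  have hsj : (s : ℕ) ≤ j := h
  rw [(Commute.all y z).add_pow', Finset.sum_div]
  refine Finset.sum_bij' (fun t _ => ((j : ℕ) - t, (t : ℕ) - s))
    (fun m hm => ⟨s + m.2, by
      have := Finset.HasAntidiagonal.mem_antidiagonal.1 hm
      have := j.2
      omega⟩) ?_ ?_ ?_ ?_ ?_
  · intro t ht
    obtain ⟨h1, h2⟩ := Finset.mem_Icc.1 ht
    have h1' : (s : ℕ) ≤ t := h1
    have h2' : (t : ℕ) ≤ j := h2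
    rw [Finset.HasAntidiagonal.mem_antidiagonal]; dsimp only; omega
  · intro m hm
    have := Finset.HasAntidiagonal.mem_antidiagonal.1 hm
    rw [Finset.mem_Icc, Fin.le_def, Fin.le_def]
    dsimp only; omega
  · intro t ht
    obtain ⟨h1, h2⟩ := Finset.mem_Icc.1 ht
    have h1' : (s : ℕ) ≤ t := h1
    ext; dsimp only; omega
  · intro m hm
    have := Finset.HasAntidiagonal.mem_antidiagonal.1 hm
    ext <;> dsimp only <;> omega
  · intro t ht
    obtain ⟨h1, h2⟩ := Finset.mem_Icc.1 ht
    have h1' : (s : ℕ) ≤ t := h1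
    have h2' : (t : ℕ) ≤ j := h2
    have e : (j : ℕ) - s - ((j : ℕ) - t) = (t : ℕ) - s := by omega
    rw [Nat.choose_eq_factorial_div_factorial (by dsimp only; omega), nsmul_eq_mul,
      Nat.cast_div (Nat.factorial_mul_factorial_dvd_factorial (by dsimp only; omega))
        (by positivity)]
    dsimp only
    rw [e]
    push_cast
    field_simp

theorem shift_shift (y z : ℝ) (u : Fin (k + 1) → ℝ) (s : Fin (k + 1)) :
    shift z (shift y u) s = shift (y + z) u s := by
  unfold shift
  simp_rw [Finset.sum_mul]
  rw [Finset.sum_comm' (t' := Finset.Ici s) (s' := fun j => Finset.Icc s j)]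
  · refine Finset.sum_congr rfl fun j hj => ?_
    rw [← sum_Icc_pow y z (Finset.mem_Ici.1 hj), Finset.mul_sum]
    refine Finset.sum_congr rfl fun t _ => ?_
    ring
  · intro a b
    simp only [Finset.mem_Ici, Finset.mem_Icc]
    exact ⟨fun h => ⟨h, h.1.trans h.2⟩, fun h => h.1⟩

theorem shift_add (z : ℝ) (u v : Fin (k + 1) → ℝ) (s : Fin (k + 1)) :
    shift z (fun t => u t + v t) s = shift z u s + shift z v s := by
  simp [shift, add_mul, Finset.sum_add_distrib]

theorem shift_neg (z : ℝ) (u : Fin (k + 1) → ℝ) (s : Fin (k + 1)) :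
    shift z (fun t => -u t) s = -shift z u s := by
  simp [shift]

theorem shift_zero (u : Fin (k + 1) → ℝ) (s : Fin (k + 1)) : shift 0 u s = u s := by
  rw [shift_eq, Finset.sum_eq_zero, add_zero]
  intro j hj
  have h' : s < j := Finset.mem_Ioi.1 hj
  have h : (s : ℕ) < j := h'
  rw [zero_pow (by omega)]
  simp

noncomputable instance : Group (JetSpace k) :=
  Group.ofLeftAxioms
    (by
      intro p q r
      ext s
      · simp only [mul_x]; ring
      · have h : (p * q).u = fun t => shift q.x p.u t + q.u t := funext fun t => mul_u p q t
        rw [mul_u, mul_u, mul_u, h, shift_add, mul_x, shift_shift]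
        ring)
    (by
      intro p
      ext s
      · simp [mul_x, one_x]
      · rw [mul_u]
        simp [shift, one_u])
    (by
      intro p
      ext s
      · simp [mul_x, inv_x, one_x]
      · have h : (p⁻¹).u = fun t => -shift (-p.x) p.u t := funext fun t => inv_u p t
        rw [mul_u, h, shift_neg, one_u, shift_shift]
        simp [shift_zero])

/-! ### Horizontal curves and the Carnot–Carathéodory distance -/

/-- A horizontal curve on `[a, b]`: all coordinates are absolutely continuous, and the contact forms
`du_j - u_{j+1} dx`, `0 ≤ j < k`, vanish on the velocity at almost every time. -/
structure IsHorizontal (γ : ℝ → JetSpace k) (a b : ℝ) : Prop where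
  ac_x : AbsolutelyContinuousOnInterval (fun τ => (γ τ).x) a b
  ac_u : ∀ j, AbsolutelyContinuousOnInterval (fun τ => (γ τ).u j) a b
  contact : ∀ᵐ τ ∂(volume.restrict (Icc a b)), ∀ j : Fin k,
    deriv (fun σ => (γ σ).u j.castSucc) τ = (γ τ).u j.succ * deriv (fun σ => (γ σ).x) τ

/-- The norm of a horizontal velocity, in the left-invariant inner product for which the frame
`X^{(k)}`, `∂/∂u_k` is orthonormal: the components in this frame are `x'` and `u_k'`. -/
noncomputable def speed (γ : ℝ → JetSpace k) (τ : ℝ) : ℝ :=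
  √((deriv (fun σ => (γ σ).x) τ) ^ 2 + (deriv (fun σ => (γ σ).u (Fin.last k)) τ) ^ 2)

/-- The length of a horizontal curve on `[a, b]`. -/
noncomputable def curveLength (γ : ℝ → JetSpace k) (a b : ℝ) : ℝ≥0∞ :=
  ∫⁻ τ in Icc a b, ENNReal.ofReal (speed γ τ)

/-- `γ` is a horizontal curve on `[a, b]` that joins `p` to `q`. -/
structure Joins (γ : ℝ → JetSpace k) (a b : ℝ) (p q : JetSpace k) : Prop where
  le : a ≤ b
  horizontal : IsHorizontal γ a b
  left : γ a = p
  right : γ b = q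

/-- The Carnot–Carathéodory distance: the infimum of the lengths of the horizontal curves that join
`p` to `q`. -/
noncomputable def ccEDist (p q : JetSpace k) : ℝ≥0∞ :=
  ⨅ (γ : ℝ → JetSpace k) (a : ℝ) (b : ℝ) (_ : Joins γ a b p q), curveLength γ a b

theorem ccEDist_le {γ : ℝ → JetSpace k} {a b : ℝ} {p q : JetSpace k} (h : Joins γ a b p q) :
    ccEDist p q ≤ curveLength γ a b :=
  iInf_le_of_le γ <| iInf_le_of_le a <| iInf_le_of_le b <| iInf_le_of_le h le_rfl

theorem exists_of_ccEDist_lt {p q : JetSpace k} {c : ℝ≥0∞} (h : ccEDist p q < c) :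
    ∃ γ a b, Joins γ a b p q ∧ curveLength γ a b < c := by
  simp only [ccEDist, iInf_lt_iff] at h
  obtain ⟨γ, a, b, hj, hl⟩ := h
  exact ⟨γ, a, b, hj, hl⟩

theorem ac_const (c a b : ℝ) : AbsolutelyContinuousOnInterval (fun _ => c) a b :=
  (LipschitzOnWith.absolutelyContinuousOnInterval (K := 0)
    (LipschitzWith.const c).lipschitzOnWith)

theorem ccEDist_self (p : JetSpace k) : ccEDist p p = 0 := by
  have h : Joins (fun _ => p) 0 0 p p :=
    ⟨le_rfl, ⟨ac_const _ _ _, fun j => ac_const _ _ _, by simp⟩, rfl, rfl⟩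
  refine le_antisymm ((ccEDist_le h).trans ?_) (zero_le)
  simp [curveLength]

theorem ac_of_integral {f g : ℝ → ℝ} {a b : ℝ} (hab : a ≤ b)
    (hg : IntervalIntegrable g volume a b) (h : ∀ τ ∈ Icc a b, f τ = f a + ∫ σ in a..τ, g σ) :
    AbsolutelyContinuousOnInterval f a b := by
  have h1 := (ac_const (f a) a b).add
    (hg.absolutelyContinuousOnInterval_intervalIntegral (left_mem_uIcc))
  rw [absolutelyContinuousOnInterval_iff] at h1 ⊢
  intro ε hε
  obtain ⟨δ, hδ, H⟩ := h1 ε hε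
  refine ⟨δ, hδ, fun E hE hl => ?_⟩
  have := H E hE hl
  convert this using 1
  refine Finset.sum_congr rfl fun i hi => ?_
  have h2 := hE.1 i hi
  rw [uIcc_of_le hab] at h2
  rw [h _ h2.1, h _ h2.2]
  rfl

theorem ac_integral {f : ℝ → ℝ} {a b τ : ℝ} (hf : AbsolutelyContinuousOnInterval f a b)
    (hτ : τ ∈ Icc a b) : f τ = f a + ∫ σ in a..τ, deriv f σ := by
  have h : AbsolutelyContinuousOnInterval f a τ := hf.mono (by
    rw [uIcc_of_le hτ.1, uIcc_of_le (hτ.1.trans hτ.2)]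
    exact Icc_subset_Icc_right hτ.2)
  rw [h.integral_deriv_eq_sub]; ring

theorem ac_reflect {f : ℝ → ℝ} {a b : ℝ} (c : ℝ) (hab : a ≤ b)
    (hf : AbsolutelyContinuousOnInterval f a b) :
    AbsolutelyContinuousOnInterval (fun τ => f (c - τ)) (c - b) (c - a) := by
  have hi : IntervalIntegrable (fun τ => deriv f (c - τ)) volume (c - b) (c - a) :=
    (hf.intervalIntegrable_deriv.comp_sub_left c).symm
  refine ac_of_integral (g := fun τ => -deriv f (c - τ)) (by linarith) hi.neg ?_
  intro τ hτ
  have h : AbsolutelyContinuousOnInterval f (c - τ) b := hf.mono (by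
    rw [uIcc_of_le hab, uIcc_of_le (by linarith [hτ.1])]
    exact Icc_subset_Icc_left (by linarith [hτ.2]))
  rw [intervalIntegral.integral_neg, intervalIntegral.integral_comp_sub_left (fun σ => deriv f σ) c,
    sub_sub_cancel, h.integral_deriv_eq_sub]
  ring

theorem ac_glue {f g : ℝ → ℝ} {a b c : ℝ} (hab : a ≤ b) (hbc : b ≤ c)
    (hf : AbsolutelyContinuousOnInterval f a b) (hg : AbsolutelyContinuousOnInterval g b c)
    (h : f b = g b) :
    AbsolutelyContinuousOnInterval (fun τ => if τ ≤ b then f τ else g τ) a c := by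
  let d : ℝ → ℝ := fun τ => if τ ≤ b then deriv f τ else deriv g τ
  have e1 : ∀ τ ≤ b, ∀ σ ∈ uIoc a τ, a ≤ τ → deriv f σ = d σ := by
    intro τ hτ σ hσ ha
    rw [uIoc_of_le ha] at hσ
    simp only [d, if_pos (hσ.2.trans hτ)]
  have e2 : ∀ τ, b ≤ τ → ∀ σ ∈ uIoc b τ, deriv g σ = d σ := by
    intro τ hτ σ hσ
    rw [uIoc_of_le hτ] at hσ
    simp only [d, if_neg (not_le.2 hσ.1)]
  have i1 : IntervalIntegrable d volume a b :=
    hf.intervalIntegrable_deriv.congr (fun σ hσ => e1 b le_rfl σ hσ hab)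
  have i2 : IntervalIntegrable d volume b c :=
    hg.intervalIntegrable_deriv.congr (fun σ hσ => e2 c hbc σ hσ)
  have j1 : ∀ τ ∈ Icc a b, ∫ σ in a..τ, d σ = f τ - f a := by
    intro τ hτ
    rw [ac_integral hf hτ, add_sub_cancel_left]
    refine (intervalIntegral.integral_congr_ae (Filter.Eventually.of_forall ?_)).symm
    exact fun σ hσ => e1 τ hτ.2 σ hσ hτ.1
  refine ac_of_integral (hab.trans hbc) (i1.trans i2) ?_
  intro τ hτ
  simp only [if_pos hab]
  rcases le_or_gt τ b with hb | hb
  · rw [if_pos hb, j1 τ ⟨hτ.1, hb⟩]; ring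
  · have i3 : IntervalIntegrable d volume b τ := i2.mono_set (by
      rw [uIcc_of_le hb.le, uIcc_of_le hbc]
      exact Icc_subset_Icc_right hτ.2)
    rw [if_neg (not_le.2 hb), ← intervalIntegral.integral_add_adjacent_intervals i1 i3,
      j1 b ⟨hab, le_rfl⟩, ac_integral hg ⟨hb.le, hτ.2⟩, h,
      intervalIntegral.integral_congr_ae (f := d) (g := deriv g)
        (Filter.Eventually.of_forall fun σ hσ => (e2 τ hb.le σ hσ).symm)]
    ring

theorem Joins.reflect {γ : ℝ → JetSpace k} {a b : ℝ} {p q : JetSpace k} (h : Joins γ a b p q)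
    (c : ℝ) : Joins (fun τ => γ (c - τ)) (c - b) (c - a) q p := by
  refine ⟨by linarith [h.le], ⟨ac_reflect (f := fun σ => (γ σ).x) c h.le h.horizontal.ac_x,
    fun j => ac_reflect (f := fun σ => (γ σ).u j) c h.le (h.horizontal.ac_u j), ?_⟩, by simp [h.right], by simp [h.left]⟩
  have h1 := h.horizontal.contact
  rw [ae_restrict_iff' measurableSet_Icc] at h1 ⊢
  filter_upwards [(quasiMeasurePreserving_sub_left volume c).ae h1]
    with τ hτ hm j
  rw [deriv_comp_const_sub (f := fun σ => (γ σ).u j.castSucc),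
    deriv_comp_const_sub (f := fun σ => (γ σ).x),
    hτ ⟨by linarith [hm.2], by linarith [hm.1]⟩ j]
  ring

theorem curveLength_reflect (γ : ℝ → JetSpace k) (a b c : ℝ) :
    curveLength (fun τ => γ (c - τ)) (c - b) (c - a) = curveLength γ a b := by
  have hs : ∀ τ, speed (fun τ => γ (c - τ)) τ = speed γ (c - τ) := by
    intro τ
    simp only [speed]
    rw [deriv_comp_const_sub (f := fun σ => (γ σ).u (Fin.last k)),
      deriv_comp_const_sub (f := fun σ => (γ σ).x), neg_sq, neg_sq]
  unfold curveLength
  rw [← lintegral_indicator measurableSet_Icc, ← lintegral_indicator measurableSet_Icc,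
    ← lintegral_sub_left_eq_self _ c]
  refine lintegral_congr fun τ => ?_
  by_cases hm : τ ∈ Icc a b
  · rw [indicator_of_mem hm, indicator_of_mem (show c - τ ∈ Icc (c - b) (c - a) from
      ⟨by linarith [hm.2], by linarith [hm.1]⟩), hs, sub_sub_cancel]
  · rw [indicator_of_notMem hm, indicator_of_notMem]
    exact fun h' => hm ⟨by linarith [h'.2], by linarith [h'.1]⟩

theorem ccEDist_comm_le (p q : JetSpace k) : ccEDist q p ≤ ccEDist p q := by
  refine le_iInf fun γ => le_iInf fun a => le_iInf fun b => le_iInf fun h => ?_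
  exact (ccEDist_le (h.reflect 0)).trans_eq (curveLength_reflect γ a b 0)

theorem deriv_glue_left {f g : ℝ → ℝ} {b τ : ℝ} (h : τ < b) :
    deriv (fun σ => if σ ≤ b then f σ else g σ) τ = deriv f τ := by
  refine Filter.EventuallyEq.deriv_eq ?_
  filter_upwards [eventually_lt_nhds h] with σ hσ
  rw [if_pos hσ.le]

theorem deriv_glue_right {f g : ℝ → ℝ} {b τ : ℝ} (h : b < τ) :
    deriv (fun σ => if σ ≤ b then f σ else g σ) τ = deriv g τ := by
  refine Filter.EventuallyEq.deriv_eq ?_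
  filter_upwards [eventually_gt_nhds h] with σ hσ
  rw [if_neg (not_le.2 hσ)]

theorem glue_x (γ₁ γ₂ : ℝ → JetSpace k) (b : ℝ) :
    (fun σ => (if σ ≤ b then γ₁ σ else γ₂ σ).x) =
      fun σ => if σ ≤ b then (γ₁ σ).x else (γ₂ σ).x := by
  funext σ; split_ifs <;> rfl

theorem glue_u (γ₁ γ₂ : ℝ → JetSpace k) (b : ℝ) (j : Fin (k + 1)) :
    (fun σ => (if σ ≤ b then γ₁ σ else γ₂ σ).u j) =
      fun σ => if σ ≤ b then (γ₁ σ).u j else (γ₂ σ).u j := by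
  funext σ; split_ifs <;> rfl

theorem Joins.glue {γ₁ γ₂ : ℝ → JetSpace k} {a b c : ℝ} {p q r : JetSpace k}
    (h₁ : Joins γ₁ a b p q) (h₂ : Joins γ₂ b c q r) :
    Joins (fun τ => if τ ≤ b then γ₁ τ else γ₂ τ) a c p r := by
  have hb : γ₁ b = γ₂ b := h₁.right.trans h₂.left.symm
  refine ⟨h₁.le.trans h₂.le, ⟨?_, fun j => ?_, ?_⟩, by simp [h₁.le, h₁.left], ?_⟩
  · rw [glue_x]
    exact ac_glue h₁.le h₂.le h₁.horizontal.ac_x h₂.horizontal.ac_x (by rw [hb])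
  · rw [glue_u]
    exact ac_glue h₁.le h₂.le (h₁.horizontal.ac_u j) (h₂.horizontal.ac_u j) (by rw [hb])
  · have e1 := h₁.horizontal.contact
    have e2 := h₂.horizontal.contact
    rw [ae_restrict_iff' measurableSet_Icc] at e1 e2 ⊢
    have hne : ∀ᵐ τ : ℝ, τ ≠ b := by simp [ae_iff]
    filter_upwards [e1, e2, hne] with τ h1 h2 hτ hm j
    rw [glue_x, glue_u]
    rcases lt_or_gt_of_ne hτ with hlt | hgt
    · rw [deriv_glue_left hlt, deriv_glue_left hlt, if_pos hlt.le, h1 ⟨hm.1, hlt.le⟩ j]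
    · rw [deriv_glue_right hgt, deriv_glue_right hgt, if_neg (not_le.2 hgt), h2 ⟨hgt.le, hm.2⟩ j]
  · rcases h₂.le.eq_or_lt with h | h
    · subst h
      simp [hb, h₂.right]
    · simp [not_le.2 h, h₂.right]

theorem curveLength_glue_le (γ₁ γ₂ : ℝ → JetSpace k) (a b c : ℝ) :
    curveLength (fun τ => if τ ≤ b then γ₁ τ else γ₂ τ) a c ≤
      curveLength γ₁ a b + curveLength γ₂ b c := by
  have hle : curveLength (fun τ => if τ ≤ b then γ₁ τ else γ₂ τ) a c ≤
      curveLength (fun τ => if τ ≤ b then γ₁ τ else γ₂ τ) a b +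
        curveLength (fun τ => if τ ≤ b then γ₁ τ else γ₂ τ) b c := by
    refine le_trans (lintegral_mono_set (t := Icc a b ∪ Icc b c) ?_) (lintegral_union_le _ _ _)
    intro τ hτ
    rcases le_total τ b with h | h
    · exact Or.inl ⟨hτ.1, h⟩
    · exact Or.inr ⟨h, hτ.2⟩
  refine hle.trans (add_le_add (le_of_eq ?_) (le_of_eq ?_))
  · refine lintegral_congr_ae ?_
    have hne : ∀ᵐ τ : ℝ, τ ≠ b := by simp [ae_iff]
    filter_upwards [ae_restrict_mem measurableSet_Icc, ae_restrict_of_ae hne] with τ hm hτ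
    have hlt : τ < b := lt_of_le_of_ne hm.2 hτ
    unfold speed
    rw [glue_x, glue_u, deriv_glue_left hlt, deriv_glue_left hlt]
  · refine lintegral_congr_ae ?_
    have hne : ∀ᵐ τ : ℝ, τ ≠ b := by simp [ae_iff]
    filter_upwards [ae_restrict_mem measurableSet_Icc, ae_restrict_of_ae hne] with τ hm hτ
    have hgt : b < τ := lt_of_le_of_ne hm.1 (Ne.symm hτ)
    unfold speed
    rw [glue_x, glue_u, deriv_glue_right hgt, deriv_glue_right hgt]

theorem ccEDist_triangle (p q r : JetSpace k) : ccEDist p r ≤ ccEDist p q + ccEDist q r := by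
  have key : ∀ γ₁ a₁ b₁ γ₂ a₂ b₂, Joins γ₁ a₁ b₁ p q → Joins γ₂ a₂ b₂ q r →
      ccEDist p r ≤ curveLength γ₁ a₁ b₁ + curveLength γ₂ a₂ b₂ := by
    intro γ₁ a₁ b₁ γ₂ a₂ b₂ h₁ h₂
    have h₃ := (h₂.reflect 0).reflect (b₁ - a₂)
    have hl := (curveLength_reflect _ _ _ (b₁ - a₂)).trans (curveLength_reflect γ₂ a₂ b₂ 0)
    rw [show b₁ - a₂ - (0 - a₂) = b₁ by ring] at h₃ hl
    refine (ccEDist_le (h₁.glue h₃)).trans ((curveLength_glue_le _ _ _ _ _).trans_eq ?_)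
    rw [hl]
  have key' : ∀ γ₁ a₁ b₁, Joins γ₁ a₁ b₁ p q →
      ccEDist p r ≤ curveLength γ₁ a₁ b₁ + ccEDist q r := by
    intro γ₁ a₁ b₁ h₁
    rw [ccEDist.eq_1 q r]
    simp only [ENNReal.add_iInf]
    exact le_iInf fun γ => le_iInf fun a => le_iInf fun b => le_iInf fun h =>
      key _ _ _ _ _ _ h₁ h
  rw [ccEDist.eq_1 p q]
  simp only [ENNReal.iInf_add]
  exact le_iInf fun γ => le_iInf fun a => le_iInf fun b => le_iInf fun h => key' _ _ _ h

theorem abs_sub_le_of_deriv_le {g : ℝ → ℝ} {γ : ℝ → JetSpace k} {a b τ M ε : ℝ} (hM : 0 ≤ M)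
    (hε : 0 ≤ ε) (hg : AbsolutelyContinuousOnInterval g a b) (hτ : τ ∈ Icc a b)
    (hd : ∀ᵐ σ ∂(volume.restrict (Icc a b)), σ ∈ Icc a τ → |deriv g σ| ≤ M * speed γ σ)
    (hL : curveLength γ a b ≤ ENNReal.ofReal ε) : |g τ - g a| ≤ M * ε := by
  rw [ac_integral hg hτ, add_sub_cancel_left, intervalIntegral.integral_of_le hτ.1]
  have h1 : ‖∫ σ in Ioc a τ, deriv g σ‖ₑ ≤ ENNReal.ofReal (M * ε) := by
    refine (enorm_integral_le_lintegral_enorm _).trans ?_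
    have hs : Ioc a τ ⊆ Icc a b := fun σ h => ⟨h.1.le, h.2.trans hτ.2⟩
    calc ∫⁻ σ in Ioc a τ, ‖deriv g σ‖ₑ
        ≤ ∫⁻ σ in Ioc a τ, ENNReal.ofReal M * ENNReal.ofReal (speed γ σ) := by
          refine lintegral_mono_ae ?_
          filter_upwards [ae_restrict_of_ae_restrict_of_subset hs hd,
            ae_restrict_mem measurableSet_Ioc] with σ h hm
          rw [← ENNReal.ofReal_mul hM, Real.enorm_eq_ofReal_abs]
          exact ENNReal.ofReal_le_ofReal (h ⟨hm.1.le, hm.2⟩)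
      _ ≤ ∫⁻ σ in Icc a b, ENNReal.ofReal M * ENNReal.ofReal (speed γ σ) := lintegral_mono_set hs
      _ = ENNReal.ofReal M * curveLength γ a b := lintegral_const_mul' _ _ ENNReal.ofReal_ne_top
      _ ≤ ENNReal.ofReal M * ENNReal.ofReal ε := by gcongr
      _ = ENNReal.ofReal (M * ε) := (ENNReal.ofReal_mul hM).symm
  rw [Real.enorm_eq_ofReal_abs] at h1
  exact (ENNReal.ofReal_le_ofReal_iff (by positivity)).1 h1

theorem abs_deriv_x_le_speed (γ : ℝ → JetSpace k) (σ : ℝ) :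
    |deriv (fun σ => (γ σ).x) σ| ≤ speed γ σ :=
  Real.abs_le_sqrt (by nlinarith [sq_nonneg (deriv (fun σ => (γ σ).u (Fin.last k)) σ)])

theorem abs_deriv_u_le_speed (γ : ℝ → JetSpace k) (σ : ℝ) :
    |deriv (fun σ => (γ σ).u (Fin.last k)) σ| ≤ speed γ σ :=
  Real.abs_le_sqrt (by nlinarith [sq_nonneg (deriv (fun σ => (γ σ).x) σ)])

theorem exists_abs_u_sub_le (p : JetSpace k) (j : Fin (k + 1)) :
    ∃ C : ℝ, 0 ≤ C ∧ ∀ (ε : ℝ) (γ : ℝ → JetSpace k) (a b : ℝ) (q : JetSpace k), 0 ≤ ε → ε ≤ 1 →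
      Joins γ a b p q → curveLength γ a b ≤ ENNReal.ofReal ε →
        ∀ τ ∈ Icc a b, |(γ τ).u j - p.u j| ≤ C * ε := by
  induction j using Fin.reverseInduction with
  | last =>
    refine ⟨1, zero_le_one, fun ε γ a b q h0 _ hJ hL τ hτ => ?_⟩
    rw [← hJ.left]
    refine abs_sub_le_of_deriv_le (γ := γ) zero_le_one h0 (hJ.horizontal.ac_u (Fin.last k)) hτ
      (Filter.Eventually.of_forall fun σ _ => ?_) hL
    rw [one_mul]
    exact abs_deriv_u_le_speed γ σ
  | cast i ih =>
    obtain ⟨C, hC, ih⟩ := ih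
    refine ⟨|p.u i.succ| + C, by positivity, fun ε γ a b q h0 h1 hJ hL τ hτ => ?_⟩
    have ih' := ih ε γ a b q h0 h1 hJ hL
    rw [← hJ.left]
    refine abs_sub_le_of_deriv_le (γ := γ) (by positivity) h0 (hJ.horizontal.ac_u i.castSucc) hτ
      ?_ hL
    filter_upwards [hJ.horizontal.contact] with σ hσ hm
    rw [hσ i, abs_mul, hJ.left]
    have h2 := ih' σ ⟨hm.1, hm.2.trans hτ.2⟩
    have h3 : |(γ σ).u i.succ| ≤ |p.u i.succ| + C := by
      have h4 : |(γ σ).u i.succ| ≤ |p.u i.succ| + |(γ σ).u i.succ - p.u i.succ| := by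
        have := abs_add_le (p.u i.succ) ((γ σ).u i.succ - p.u i.succ)
        simpa using this
      nlinarith
    exact mul_le_mul h3 (abs_deriv_x_le_speed γ σ) (abs_nonneg _) (by positivity)

theorem eq_of_abs_sub_le {c d C : ℝ} (h : ∀ ε : ℝ, 0 < ε → ε ≤ 1 → |d - c| ≤ C * ε) : c = d := by
  by_contra hne
  have hpos : 0 < |d - c| := abs_pos.2 (sub_ne_zero.2 (Ne.symm hne))
  have h1 := h 1 one_pos le_rfl
  have hC : 0 < C := by linarith
  have h2 := h (min 1 (|d - c| / (2 * C))) (by positivity) (min_le_left _ _)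
  have h3 : C * min 1 (|d - c| / (2 * C)) ≤ C * (|d - c| / (2 * C)) := by
    gcongr
    exact min_le_right _ _
  have h4 : C * (|d - c| / (2 * C)) = |d - c| / 2 := by field_simp
  linarith

theorem eq_of_ccEDist_eq_zero {p q : JetSpace k} (h : ccEDist p q = 0) : p = q := by
  have hex : ∀ ε : ℝ, 0 < ε → ∃ γ a b, Joins γ a b p q ∧ curveLength γ a b < ENNReal.ofReal ε :=
    fun ε hε => exists_of_ccEDist_lt (by rw [h]; exact ENNReal.ofReal_pos.2 hε)
  ext j
  · refine eq_of_abs_sub_le (C := 1) fun ε h0 _ => ?_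
    obtain ⟨γ, a, b, hJ, hL⟩ := hex ε h0
    rw [← hJ.left, ← hJ.right]
    refine abs_sub_le_of_deriv_le (γ := γ) zero_le_one h0.le hJ.horizontal.ac_x
      (right_mem_Icc.2 hJ.le) (Filter.Eventually.of_forall fun σ _ => ?_) hL.le
    rw [one_mul]
    exact abs_deriv_x_le_speed γ σ
  · obtain ⟨C, _, hC⟩ := exists_abs_u_sub_le p j
    refine eq_of_abs_sub_le (C := C) fun ε h0 h1 => ?_
    obtain ⟨γ, a, b, hJ, hL⟩ := hex ε h0
    have := hC ε γ a b q h0.le h1 hJ hL.le b (right_mem_Icc.2 hJ.le)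
    rwa [hJ.right] at this

/-- `J^k(ℝ)` is equipped with the Carnot–Carathéodory metric and with its topology. -/
noncomputable instance : EMetricSpace (JetSpace k) where
  edist := ccEDist
  edist_self := ccEDist_self
  edist_comm p q := le_antisymm (ccEDist_comm_le q p) (ccEDist_comm_le p q)
  edist_triangle := ccEDist_triangle
  eq_of_edist_eq_zero := eq_of_ccEDist_eq_zero

/-! ### Jets and vertical mappings -/

/-- The jet `j^k_x(f) = (x, f^{(k)}(x), …, f(x))`. -/
noncomputable def jet (k : ℕ) (f : ℝ → ℝ) (x : ℝ) : JetSpace k :=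
  ⟨x, fun j => iteratedDeriv j f x⟩

/-- The vertical mapping `V_{f,t}(p) = p ⊙ j^k_{x-t}(f)⁻¹`, where `x` is the first coordinate of
`p`. -/
noncomputable def verticalMap (f : ℝ → ℝ) (t : ℝ) (p : JetSpace k) : JetSpace k :=
  p * (jet k f (p.x - t))⁻¹

end JetSpace

/-! The set `E` consists of two copies of a compact `K ⊆ [0, 1]` of dimension `μ`, placed on the
lines in direction `∂/∂u_k` over `x = 0` and `x = 1`. These lines are isometric to `ℝ`, so `dimH E =
μ`. Over a fixed `x = c` the jet in the vertical mapping is one group element. Moving the vertical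
factor `s e_k` past its inverse applies the Taylor shift by `t - c`, so the line becomes a left
coset `g * vert (s • w)` with `w_j = (t - c)^(k-j) / (k-j)!` (`verticalMap_vertLine`).

The coordinate `u_j` has weight `k + 1 - j`. A vertical displacement of distance `d` satisfies
`|w_j| ≤ d^(k+1-j)` (`ofReal_abs_le_edist_pow`), and conversely a displacement with `|w_j| ≤ B
r^(k+1-j)` for all `j` costs at most a constant times `r` (`exists_edist_mul_vert_le`). Hence
bounded pieces of vertical lines have dimension at most `k + 1` times that of the parameter set,
with equality when `w_0 ≠ 0`, that is, on the fibres `c ≠ t`. No `t` equals both `0` and `1`, so one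
of the two copies always attains the bound. -/

/-! ### Hausdorff dimension and Hölder comparison of two parametrisations. -/

/-- The estimate forces `g` to factor through `h` on `s`, and the factor is `r`-Hölder. Stating it
with two parametrisations avoids inverting `h` in each application. -/
theorem dimH_image_le_of_edist_le {ι X Y : Type*} [EMetricSpace X] [EMetricSpace Y] {g : ι → X}
    {h : ι → Y} {s : Set ι} {C r : NNReal} (hr : 0 < r)
    (H : ∀ i ∈ s, ∀ j ∈ s, edist (g i) (g j) ≤ C * edist (h i) (h j) ^ (r : ℝ)) :
    dimH (g '' s) ≤ dimH (h '' s) / r := by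
  rcases s.eq_empty_or_nonempty with rfl | ⟨i₀, -⟩
  · simp
  have : Nonempty ι := ⟨i₀⟩
  let G : Y → X := fun y => g (Function.invFunOn h s y)
  have hm : ∀ i ∈ s, Function.invFunOn h s (h i) ∈ s := fun i hi =>
    Function.invFunOn_mem ⟨i, hi, rfl⟩
  have he : ∀ i ∈ s, h (Function.invFunOn h s (h i)) = h i := fun i hi =>
    Function.invFunOn_eq ⟨i, hi, rfl⟩
  have hG : HolderOnWith C r G (h '' s) := by
    rintro _ ⟨i, hi, rfl⟩ _ ⟨j, hj, rfl⟩
    have := H _ (hm i hi) _ (hm j hj)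
    rwa [he i hi, he j hj] at this
  have hs : g '' s ⊆ G '' (h '' s) := by
    rintro _ ⟨i, hi, rfl⟩
    refine ⟨h i, mem_image_of_mem h hi, ?_⟩
    have := H _ (hm i hi) _ hi
    rw [he i hi, edist_self, ENNReal.zero_rpow_of_pos (by exact_mod_cast hr), mul_zero] at this
    exact edist_le_zero.1 this
  exact (dimH_mono hs).trans (hG.dimH_image_le hr)

/-! ### Cantor sets of prescribed dimension in the line. -/

/-- The point of the Cantor set of contraction ratio `c` with address `d`. -/
noncomputable def cantorPoint (c : ℝ) (d : ℕ → Fin 2) : ℝ :=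
  (1 - c) * ∑' i, (d i : ℝ) * c ^ i

section Cantor

variable {c : ℝ}

theorem fin_two_cast_le_one (a : Fin 2) : (a : ℝ) ≤ 1 := by
  fin_cases a <;> simp

theorem cantorPoint_summable (h0 : 0 ≤ c) (h1 : c < 1) (d : ℕ → Fin 2) :
    Summable fun i => (d i : ℝ) * c ^ i :=
  Summable.of_nonneg_of_le (fun i => by positivity)
    (fun i => mul_le_of_le_one_left (by positivity) (fin_two_cast_le_one _))
    (summable_geometric_of_lt_one h0 h1)

theorem cantorPoint_succ (h0 : 0 ≤ c) (h1 : c < 1) (d : ℕ → Fin 2) :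
    cantorPoint c d = (1 - c) * d 0 + c * cantorPoint c fun i => d (i + 1) := by
  unfold cantorPoint
  rw [(cantorPoint_summable h0 h1 d).tsum_eq_zero_add]
  have : ∑' i, (d (i + 1) : ℝ) * c ^ (i + 1) = c * ∑' i, (d (i + 1) : ℝ) * c ^ i := by
    rw [← tsum_mul_left]
    exact tsum_congr fun i => by ring
  rw [this]
  ring

theorem cantorPoint_mem_Icc (h0 : 0 ≤ c) (h1 : c < 1) (d : ℕ → Fin 2) :
    cantorPoint c d ∈ Icc (0 : ℝ) 1 := by
  have h2 : 0 < 1 - c := by linarith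
  refine ⟨mul_nonneg h2.le (tsum_nonneg fun i => by positivity), ?_⟩
  calc cantorPoint c d ≤ (1 - c) * ∑' i, c ^ i := by
        refine mul_le_mul_of_nonneg_left ?_ h2.le
        exact (cantorPoint_summable h0 h1 d).tsum_le_tsum
          (fun i => mul_le_of_le_one_left (by positivity) (fin_two_cast_le_one _))
          (summable_geometric_of_lt_one h0 h1)
    _ = 1 := by
        rw [tsum_geometric_of_lt_one h0 h1, mul_inv_cancel₀ h2.ne']

theorem abs_cantorPoint_sub_le (h0 : 0 ≤ c) (h1 : c < 1) (n : ℕ) :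
    ∀ d e : ℕ → Fin 2, (∀ i < n, d i = e i) → |cantorPoint c d - cantorPoint c e| ≤ c ^ n := by
  induction n with
  | zero =>
    intro d e _
    have hd := cantorPoint_mem_Icc h0 h1 d
    have he := cantorPoint_mem_Icc h0 h1 e
    rw [pow_zero, abs_le]
    constructor <;> linarith [hd.1, hd.2, he.1, he.2]
  | succ n ih =>
    intro d e h
    rw [cantorPoint_succ h0 h1 d, cantorPoint_succ h0 h1 e, h 0 n.succ_pos, add_sub_add_left_eq_sub,
      ← mul_sub, abs_mul, abs_of_nonneg h0, pow_succ']
    exact mul_le_mul_of_nonneg_left (ih _ _ fun i hi => h _ (by omega)) h0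

/-- Each common leading digit scales the difference by `c`. At the first disagreement one point lies
in `[0, c]` and the other in `[1 - c, 1]`, and these are `1 - 2c` apart when `c < 1/2`. -/
theorem le_abs_cantorPoint_sub (h0 : 0 ≤ c) (h1 : c < 1) (n : ℕ) :
    ∀ d e : ℕ → Fin 2, (∀ i < n, d i = e i) → d n ≠ e n →
      (1 - 2 * c) * c ^ n ≤ |cantorPoint c d - cantorPoint c e| := by
  induction n with
  | zero =>
    intro d e _ h
    have hd := cantorPoint_mem_Icc h0 h1 fun i => d (i + 1)
    have he := cantorPoint_mem_Icc h0 h1 fun i => e (i + 1)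
    rw [cantorPoint_succ h0 h1 d, cantorPoint_succ h0 h1 e, pow_zero, mul_one]
    have a1 := mul_nonneg h0 hd.1
    have a2 := mul_nonneg h0 he.1
    have a3 := mul_le_mul_of_nonneg_left hd.2 h0
    have a4 := mul_le_mul_of_nonneg_left he.2 h0
    have : (d 0 = 0 ∧ e 0 = 1) ∨ (d 0 = 1 ∧ e 0 = 0) := by omega
    rcases this with ⟨h2, h3⟩ | ⟨h2, h3⟩
    · rw [h2, h3, abs_sub_comm, le_abs]
      left
      simp only [Fin.val_zero, Fin.val_one, Nat.cast_zero, Nat.cast_one]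
      linarith
    · rw [h2, h3, le_abs]
      left
      simp only [Fin.val_zero, Fin.val_one, Nat.cast_zero, Nat.cast_one]
      linarith
  | succ n ih =>
    intro d e h hn
    rw [cantorPoint_succ h0 h1 d, cantorPoint_succ h0 h1 e, h 0 n.succ_pos, add_sub_add_left_eq_sub,
      ← mul_sub, abs_mul, abs_of_nonneg h0, pow_succ', mul_left_comm]
    exact mul_le_mul_of_nonneg_left (ih _ _ (fun i hi => h _ (by omega)) hn) h0

theorem continuous_cantorPoint (h0 : 0 ≤ c) (h1 : c < 1) : Continuous (cantorPoint c) := by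
  refine continuous_const.mul (continuous_tsum (u := fun i => c ^ i) (fun i => ?_)
    (summable_geometric_of_lt_one h0 h1) fun i d => ?_)
  · exact ((continuous_of_discreteTopology (f := fun a : Fin 2 => (a : ℝ))).comp
      (continuous_apply i)).mul continuous_const
  · rw [Real.norm_of_nonneg (by positivity)]
    exact mul_le_of_le_one_left (by positivity) (fin_two_cast_le_one _)

/-- The `2^n` cylinders of level `n` have diameter at most `c^n`, and `(c^n)^μ = 2^(-n)`, so the
`μ`-dimensional measure is at most `1`. -/
theorem dimH_range_cantorPoint_le {μ : NNReal} (h0 : 0 < c) (h1 : c < 1)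
    (hμ : c ^ (μ : ℝ) = 1 / 2) : dimH (range (cantorPoint c)) ≤ μ := by
  borelize ℝ
  refine dimH_le_of_hausdorffMeasure_ne_top (ne_top_of_le_ne_top ENNReal.one_ne_top ?_)
  have hdiam : ∀ (n : ℕ) (w : Fin n → Fin 2),
      Metric.ediam (cantorPoint c '' {d | ∀ i : Fin n, d i = w i}) ≤ ENNReal.ofReal (c ^ n) := by
    intro n w
    refine Metric.ediam_le ?_
    rintro _ ⟨d, hd, rfl⟩ _ ⟨e, he, rfl⟩
    rw [edist_dist, Real.dist_eq]
    exact ENNReal.ofReal_le_ofReal (abs_cantorPoint_sub_le h0.le h1 n d e fun i hi =>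
      (hd ⟨i, hi⟩).trans (he ⟨i, hi⟩).symm)
  refine (Measure.hausdorffMeasure_le_liminf_sum (β := ℕ) (ι := fun n => Fin n → Fin 2) μ
    (range (cantorPoint c)) (l := Filter.atTop) (fun n => ENNReal.ofReal (c ^ n)) ?_
    (fun n w => cantorPoint c '' {d | ∀ i : Fin n, d i = w i})
    (Filter.Eventually.of_forall hdiam) (Filter.Eventually.of_forall ?_)).trans ?_
  · rw [← ENNReal.ofReal_zero]
    exact (ENNReal.continuous_ofReal.tendsto 0).comp (tendsto_pow_atTop_nhds_zero_of_lt_one h0.le h1)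
  · rintro n _ ⟨d, rfl⟩
    exact mem_iUnion.2 ⟨fun i => d i, d, fun i => rfl, rfl⟩
  · refine Filter.liminf_le_of_le (by isBoundedDefault) fun b hb => ?_
    obtain ⟨n, hn⟩ := hb.exists
    refine hn.trans ?_
    calc ∑ w : Fin n → Fin 2, Metric.ediam (cantorPoint c '' {d | ∀ i : Fin n, d i = w i}) ^ (μ : ℝ)
        ≤ ∑ w : Fin n → Fin 2, ENNReal.ofReal ((1 / 2) ^ n) := by
          refine Finset.sum_le_sum fun w _ => ?_
          refine (ENNReal.rpow_le_rpow (hdiam n w) μ.coe_nonneg).trans_eq ?_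
          rw [ENNReal.ofReal_rpow_of_nonneg (by positivity) μ.coe_nonneg, ← hμ, ← Real.rpow_natCast,
            ← Real.rpow_natCast, ← Real.rpow_mul h0.le, ← Real.rpow_mul h0.le, mul_comm]
      _ = 1 := by
          rw [Finset.sum_const, Finset.card_univ, Fintype.card_fun, Fintype.card_fin,
            Fintype.card_fin, nsmul_eq_mul, ← ENNReal.ofReal_natCast,
            ← ENNReal.ofReal_mul (by positivity)]
          push_cast
          rw [← mul_pow]
          norm_num

/-- Reading an address as a binary expansion maps the Cantor set onto `[0, 1]`. This map is
`μ`-Hölder, because two points that first differ at digit `n` are at least `(1 - 2c) c^n` apart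
while their images differ by at most `2^(-n) = (c^n)^μ`. -/
theorem le_dimH_range_cantorPoint {μ : NNReal} (h0 : 0 < c) (h1 : c < 1 / 2) (hμ0 : 0 < μ)
    (hμ : c ^ (μ : ℝ) = 1 / 2) : μ ≤ dimH (range (cantorPoint c)) := by
  have hpos : 0 < 1 - 2 * c := by linarith
  let C : NNReal := ⟨((1 - 2 * c)⁻¹) ^ (μ : ℝ), by positivity⟩
  have key : dimH ((Real.ofDigits (b := 2)) '' univ) ≤ dimH (cantorPoint c '' univ) / μ := by
    refine dimH_image_le_of_edist_le (C := C) hμ0 fun d _ e _ => ?_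
    rcases eq_or_ne d e with rfl | hne
    · simp
    have hex : ∃ n, d n ≠ e n := by
      by_contra! h
      exact hne (funext h)
    classical
    have hlt : ∀ i < Nat.find hex, d i = e i := fun i hi => not_not.1 (Nat.find_min hex hi)
    have hl := le_abs_cantorPoint_sub h0.le (by linarith) _ d e hlt (Nat.find_spec hex)
    have hu := Real.abs_ofDigits_sub_ofDigits_le hlt
    rw [edist_dist, edist_dist, Real.dist_eq, Real.dist_eq,
      ENNReal.ofReal_rpow_of_nonneg (abs_nonneg _) μ.coe_nonneg, ← ENNReal.ofReal_coe_nnreal,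
      ← ENNReal.ofReal_mul C.coe_nonneg]
    refine ENNReal.ofReal_le_ofReal (hu.trans ?_)
    change _ ≤ ((1 - 2 * c)⁻¹) ^ (μ : ℝ) * _
    rw [← Real.mul_rpow (by positivity) (abs_nonneg _)]
    calc (((2 : ℕ) : ℝ) ^ (Nat.find hex))⁻¹ = (c ^ (Nat.find hex)) ^ (μ : ℝ) := by
          rw [← Real.rpow_natCast c, ← Real.rpow_mul h0.le, mul_comm, Real.rpow_mul h0.le, hμ,
            Real.rpow_natCast]
          simp
      _ ≤ _ := by
          refine Real.rpow_le_rpow (by positivity) ?_ μ.coe_nonneg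
          rw [inv_mul_eq_div, le_div_iff₀ hpos]
          linarith
  have h2 : (1 : ℝ≥0∞) ≤ dimH ((Real.ofDigits (b := 2)) '' univ) := by
    have h3 : dimH (Icc (0 : ℝ) 1) = 1 := by
      rw [Real.dimH_of_nonempty_interior (by simp)]
      simp
    rw [← h3]
    exact dimH_mono (Real.ofDigits_SurjOn one_lt_two)
  have h4 := h2.trans key
  rw [image_univ, ENNReal.le_div_iff_mul_le (by simp [hμ0.ne']) (by simp), one_mul] at h4
  exact h4

end Cantor

theorem exists_isCompact_dimH_eq {μ : ℝ} (hμ₀ : 0 ≤ μ) (hμ₁ : μ ≤ 1) :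
    ∃ K : Set ℝ, IsCompact K ∧ K ⊆ Icc 0 1 ∧ dimH K = ENNReal.ofReal μ := by
  rcases hμ₀.eq_or_lt with rfl | h0
  · exact ⟨{0}, isCompact_singleton, by simp, by simp⟩
  rcases hμ₁.eq_or_lt with rfl | h1
  · refine ⟨Icc 0 1, isCompact_Icc, Subset.rfl, ?_⟩
    rw [Real.dimH_of_nonempty_interior (by simp)]
    simp
  lift μ to NNReal using hμ₀
  -- The ratio solves `c^μ = 1/2`; it is below `1/2` exactly because `μ < 1`, so `μ = 1` had to be
  -- treated apart.
  have hc0 : (0 : ℝ) < (1 / 2) ^ (μ : ℝ)⁻¹ := by positivity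
  have hc1 : ((1 : ℝ) / 2) ^ (μ : ℝ)⁻¹ < 1 / 2 := by
    conv_rhs => rw [← Real.rpow_one (1 / 2)]
    exact Real.rpow_lt_rpow_of_exponent_gt (by norm_num) (by norm_num) ((one_lt_inv₀ h0).2 h1)
  have hc : (((1 : ℝ) / 2) ^ (μ : ℝ)⁻¹) ^ (μ : ℝ) = 1 / 2 := by
    rw [← Real.rpow_mul (by norm_num), inv_mul_cancel₀ h0.ne', Real.rpow_one]
  refine ⟨range (cantorPoint ((1 / 2) ^ (μ : ℝ)⁻¹)),
    isCompact_range (continuous_cantorPoint hc0.le (by linarith)), ?_, ?_⟩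
  · rintro _ ⟨d, rfl⟩
    exact cantorPoint_mem_Icc hc0.le (by linarith) d
  · rw [ENNReal.ofReal_coe_nnreal]
    exact le_antisymm (dimH_range_cantorPoint_le hc0 (by linarith) hc)
      (le_dimH_range_cantorPoint hc0 hc1 (by exact_mod_cast h0) hc)

/-! ### Calculus of the Taylor shift. -/

namespace JetSpace

variable {k : ℕ}

theorem ac_pow {f : ℝ → ℝ} {a b : ℝ} (hf : AbsolutelyContinuousOnInterval f a b) (n : ℕ) :
    AbsolutelyContinuousOnInterval (fun τ => f τ ^ n) a b := by
  induction n with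
  | zero => simpa using ac_const 1 a b
  | succ n ih =>
    simp_rw [pow_succ]
    exact ih.fun_mul hf

theorem ac_sum {ι : Type*} (s : Finset ι) {f : ι → ℝ → ℝ} {a b : ℝ}
    (hf : ∀ i, AbsolutelyContinuousOnInterval (f i) a b) :
    AbsolutelyContinuousOnInterval (fun τ => ∑ i ∈ s, f i τ) a b := by
  classical
  induction s using Finset.induction_on with
  | empty => simpa using ac_const 0 a b
  | insert i s hi ih =>
    simp_rw [Finset.sum_insert hi]
    exact (hf i).fun_add ih

theorem ac_shift {f : ℝ → ℝ} {a b : ℝ} (hf : AbsolutelyContinuousOnInterval f a b)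
    (u : Fin (k + 1) → ℝ) (j : Fin (k + 1)) :
    AbsolutelyContinuousOnInterval (fun τ => shift (f τ) u j) a b := by
  unfold shift
  refine ac_sum _ fun i => ?_
  simp_rw [div_eq_inv_mul]
  exact ((ac_pow hf _).const_mul _).const_mul _

theorem shift_last (y : ℝ) (u : Fin (k + 1) → ℝ) : shift y u (Fin.last k) = u (Fin.last k) := by
  rw [shift_eq, Finset.sum_eq_zero, add_zero]
  intro j hj
  exact absurd (Finset.mem_Ioi.1 hj) (not_lt.2 (Fin.le_last j))

/-- The shift lists the derivatives at `y` of the polynomial with jet `u` at `0`. This is why the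
curves `τ ↦ p * ⟨s * τ, 0⟩` satisfy the contact equations. -/
theorem hasDerivAt_shift (y : ℝ) (u : Fin (k + 1) → ℝ) (j : Fin k) :
    HasDerivAt (fun z => shift z u j.castSucc) (shift y u j.succ) y := by
  have hI : Finset.Ioi j.castSucc = Finset.Ici j.succ := by
    ext i
    simp [Fin.castSucc_lt_iff_succ_le]
  simp_rw [shift_eq _ u j.castSucc, hI]
  refine HasDerivAt.const_add _ (HasDerivAt.fun_sum fun i hi => HasDerivAt.const_mul _ ?_)
  have hle : j.succ ≤ i := Finset.mem_Ici.1 hi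
  rw [Fin.le_def, Fin.val_succ] at hle
  obtain ⟨n, hn⟩ := Nat.exists_eq_add_of_le hle
  have h1 : (i : ℕ) - (j.castSucc : Fin (k + 1)) = n + 1 := by
    rw [Fin.val_castSucc]; omega
  have h2 : (i : ℕ) - (j.succ : Fin (k + 1)) = n := by
    rw [Fin.val_succ]; omega
  rw [h1, h2]
  refine ((hasDerivAt_pow (n + 1) y).div_const _).congr_deriv ?_
  rw [Nat.factorial_succ]
  push_cast
  field_simp

theorem contDiff_shift (u : Fin (k + 1) → ℝ) (j : Fin (k + 1)) :
    ContDiff ℝ 1 fun y => shift y u j :=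
  ContDiff.sum fun _ _ => contDiff_const.mul ((contDiff_id.pow _).div_const _)

/-! ### The vertical subgroup. -/

/-- The points of the vertical subgroup `{x = 0}`. -/
def vert (w : Fin (k + 1) → ℝ) : JetSpace k := ⟨0, w⟩

theorem mul_vert_u (p : JetSpace k) (w : Fin (k + 1) → ℝ) (j : Fin (k + 1)) :
    (p * vert w).u j = p.u j + w j := by
  rw [mul_u]
  exact congrArg (· + w j) (shift_zero _ _)

theorem mul_vert_x (p : JetSpace k) (w : Fin (k + 1) → ℝ) : (p * vert w).x = p.x :=
  add_zero _

theorem vert_mul_vert (v w : Fin (k + 1) → ℝ) : vert v * vert w = vert (v + w) := by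
  ext j
  · exact mul_vert_x _ _
  · exact mul_vert_u _ _ _

theorem vert_zero : vert (0 : Fin (k + 1) → ℝ) = 1 := rfl

/-- Conjugation acts on the vertical subgroup through `g.x` alone. This shear is what can tilt the
direction `∂/∂u_k` towards `∂/∂u_0`. -/
theorem vert_mul (w : Fin (k + 1) → ℝ) (g : JetSpace k) :
    vert w * g = g * vert (shift g.x w) := by
  ext j
  · rw [mul_vert_x, mul_x]
    exact zero_add _
  · rw [mul_vert_u, mul_u, add_comm]
    rfl

/-! ### Upper bounds for the distance. -/

theorem curveLength_of_speed_eq {γ : ℝ → JetSpace k} {c : ℝ} (h : ∀ τ, speed γ τ = c) :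
    curveLength γ 0 1 = ENNReal.ofReal c := by
  simp [curveLength, h]

theorem edist_mul_line_le (p : JetSpace k) (s : ℝ) :
    edist p (p * ⟨s, 0⟩) ≤ ENNReal.ofReal |s| := by
  let γ : ℝ → JetSpace k := fun τ => p * ⟨s * τ, 0⟩
  have hx : ∀ τ, HasDerivAt (fun σ => (γ σ).x) s τ := fun τ => by
    change HasDerivAt (fun σ => p.x + s * σ) s τ
    simpa using ((hasDerivAt_id τ).const_mul s).const_add p.x
  have hux : ∀ j, (fun σ => (γ σ).u j) = fun σ => shift (s * σ) p.u j := fun j => by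
    funext σ
    simp only [γ, mul_u]
    exact add_zero _
  have hJ : Joins γ 0 1 p (p * ⟨s, 0⟩) := by
    refine ⟨zero_le_one, ⟨?_, fun j => ?_, Filter.Eventually.of_forall fun τ j => ?_⟩, ?_, ?_⟩
    · exact (contDiff_const.add (contDiff_const.mul contDiff_id) :
        ContDiff ℝ 1 fun σ => p.x + s * σ).contDiffOn.absolutelyContinuousOnInterval
    · rw [hux]
      exact ((contDiff_shift p.u j).comp
        (contDiff_const.mul contDiff_id)).contDiffOn.absolutelyContinuousOnInterval
    · rw [hux, (hx τ).deriv]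
      have hc := (hasDerivAt_shift (s * τ) p.u j).comp τ ((hasDerivAt_id τ).const_mul s)
      rw [mul_one] at hc
      exact hc.deriv.trans (by rw [← congrFun (hux j.succ) τ])
    · change p * ⟨s * 0, 0⟩ = p
      rw [mul_zero]
      exact mul_one p
    · change p * ⟨s * 1, 0⟩ = _
      rw [mul_one]
  refine (ccEDist_le hJ).trans_eq (curveLength_of_speed_eq fun τ => ?_)
  rw [speed, (hx τ).deriv, hux]
  simp_rw [shift_last]
  rw [deriv_const, zero_pow two_ne_zero, add_zero, Real.sqrt_sq_eq_abs]

theorem edist_mul_vert_single_le (p : JetSpace k) (s : ℝ) :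
    edist p (p * vert (Pi.single (Fin.last k) s)) ≤ ENNReal.ofReal |s| := by
  let e : Fin (k + 1) → ℝ := Pi.single (Fin.last k) s
  let γ : ℝ → JetSpace k := fun τ => p * vert (fun j => e j * τ)
  have hx : ∀ τ, deriv (fun σ => (γ σ).x) τ = 0 := fun τ => by
    simp only [γ, mul_vert_x, deriv_const]
  have hu : ∀ j τ, HasDerivAt (fun σ => (γ σ).u j) (e j) τ := fun j τ => by
    simp only [γ, mul_vert_u]
    simpa using ((hasDerivAt_id τ).const_mul (e j)).const_add (p.u j)
  have hJ : Joins γ 0 1 p (p * vert e) := by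
    refine ⟨zero_le_one, ⟨?_, fun j => ?_, Filter.Eventually.of_forall fun τ j => ?_⟩, ?_, ?_⟩
    · simp only [γ, mul_vert_x]
      exact ac_const _ _ _
    · simp only [γ, mul_vert_u]
      exact (contDiff_const.add (contDiff_const.mul contDiff_id) :
        ContDiff ℝ 1 fun σ => p.u j + e j * σ).contDiffOn.absolutelyContinuousOnInterval
    · rw [(hu _ τ).deriv, hx τ, mul_zero]
      exact Pi.single_eq_of_ne (M := fun _ => ℝ) (Fin.castSucc_lt_last j).ne s
    · simp only [γ, mul_zero]
      exact mul_one p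
    · simp only [γ, mul_one]
  refine (ccEDist_le hJ).trans_eq (curveLength_of_speed_eq fun τ => ?_)
  rw [speed, (hu _ τ).deriv, hx τ, zero_pow two_ne_zero, zero_add, Real.sqrt_sq_eq_abs]
  simp [e]

/-- The coordinates of the Taylor shift by `y` of the last coordinate vector. -/
noncomputable def moment (k : ℕ) (y : ℝ) (j : Fin (k + 1)) : ℝ := y ^ (k - (j : ℕ)) / (k - (j : ℕ))!

theorem shift_single (y s : ℝ) : shift y (Pi.single (Fin.last k) s) = s • moment k y := by
  funext j
  unfold shift
  rw [Finset.sum_eq_single (Fin.last k)]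
  · simp [moment]
  · intro i _ hi
    simp [hi]
  · intro h
    exact absurd (Finset.mem_Ici.2 (Fin.le_last j)) h

/-- Travel `-y` along `X^{(k)}`, then `s` along `∂/∂u_k`, then `y` along `X^{(k)}`: by `vert_mul`
the net displacement is vertical. -/
theorem edist_mul_vert_moment_le (p : JetSpace k) (y s : ℝ) :
    edist p (p * vert (s • moment k y)) ≤ ENNReal.ofReal (2 * |y| + |s|) := by
  have hinv : (⟨-y, 0⟩ * ⟨y, 0⟩ : JetSpace k) = 1 := by
    ext j
    · exact neg_add_cancel y
    · rw [mul_u]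
      simp [shift, one_u]
  have e : p * vert (s • moment k y) =
      p * ⟨-y, 0⟩ * vert (Pi.single (Fin.last k) s) * ⟨y, 0⟩ := by
    rw [mul_assoc, vert_mul, ← mul_assoc, mul_assoc p, hinv, mul_one, shift_single]
  rw [e]
  refine ((edist_triangle4 _ _ _ _).trans (add_le_add_three (edist_mul_line_le p (-y))
    (edist_mul_vert_single_le _ s) (edist_mul_line_le _ y))).trans_eq ?_
  rw [← ENNReal.ofReal_add (by positivity) (by positivity),
    ← ENNReal.ofReal_add (by positivity) (by positivity), abs_neg]
  congr 1
  ring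

theorem edist_mul_vert_sum_le {ι : Type*} (S : Finset ι) (y s : ι → ℝ) (p : JetSpace k) :
    edist p (p * vert (∑ i ∈ S, s i • moment k (y i))) ≤
      ENNReal.ofReal (∑ i ∈ S, (2 * |y i| + |s i|)) := by
  classical
  induction S using Finset.induction_on with
  | empty => simp [vert_zero]
  | insert i S hi ih =>
    rw [Finset.sum_insert hi, Finset.sum_insert hi, add_comm (s i • _), ← vert_mul_vert, ← mul_assoc,
      add_comm (2 * |y i| + |s i|), ENNReal.ofReal_add (by positivity) (by positivity)]
    exact (edist_triangle _ _ _).trans (add_le_add ih (edist_mul_vert_moment_le _ _ _))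

/-- The moment vectors at the nodes `0, …, k` form a basis, by the Vandermonde determinant; `C`
bounds the inverse matrix. -/
theorem exists_sum_moment_eq (k : ℕ) : ∃ C : ℝ, 0 ≤ C ∧ ∀ z : Fin (k + 1) → ℝ, ∀ B : ℝ,
    (∀ j, |z j| ≤ B) → ∃ a : Fin (k + 1) → ℝ, (∀ i, |a i| ≤ C * B) ∧
      ∀ j, ∑ i, a i * moment k (i : ℝ) j = z j := by
  let v : Fin (k + 1) → ℝ := fun i => (i : ℕ)
  let V := (Matrix.vandermonde v).transpose
  have hV : IsUnit V.det := by
    rw [Matrix.det_transpose, isUnit_iff_ne_zero, Matrix.det_vandermonde_ne_zero_iff]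
    intro i j h
    exact Fin.ext (Nat.cast_injective (R := ℝ) h)
  have hle : ∀ i, ∑ n, |V⁻¹ i n| * (n : ℕ)! ≤ ∑ i, ∑ n, |V⁻¹ i n| * (n : ℕ)! := fun i =>
    Finset.single_le_sum (f := fun i => ∑ n, |V⁻¹ i n| * ((n : ℕ)! : ℝ))
      (fun i _ => by positivity) (Finset.mem_univ i)
  refine ⟨∑ i, ∑ n, |V⁻¹ i n| * (n : ℕ)!, by positivity, fun z B hz => ?_⟩
  have hB : 0 ≤ B := (abs_nonneg _).trans (hz 0)
  -- Row `n` of `V` holds `n`-th powers, whereas coordinate `j` of a moment is a power `k - j` over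
  -- a factorial; hence the reversal and the factor `n!`.
  let y : Fin (k + 1) → ℝ := fun n => (n : ℕ)! * z n.rev
  refine ⟨V⁻¹.mulVec y, fun i => ?_, fun j => ?_⟩
  · calc |V⁻¹.mulVec y i| ≤ ∑ n, |V⁻¹ i n * y n| :=
          Finset.abs_sum_le_sum_abs (fun n => V⁻¹ i n * y n) Finset.univ
      _ ≤ ∑ n, |V⁻¹ i n| * (n : ℕ)! * B := by
          refine Finset.sum_le_sum fun n _ => ?_
          rw [abs_mul, abs_mul, Nat.abs_cast, mul_assoc]
          gcongr
          exact hz _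
      _ = (∑ n, |V⁻¹ i n| * (n : ℕ)!) * B := (Finset.sum_mul _ _ _).symm
      _ ≤ _ := mul_le_mul_of_nonneg_right (hle i) hB
  · have h : V.mulVec (V⁻¹.mulVec y) j.rev = y j.rev := by
      rw [Matrix.mulVec_mulVec, Matrix.mul_nonsing_inv _ hV, Matrix.one_mulVec]
    have hj : ((j.rev : Fin (k + 1)) : ℕ) = k - j := by
      rw [Fin.val_rev]; omega
    have hy : y j.rev = (k - (j : ℕ))! * z j := by simp only [y, Fin.rev_rev, hj]
    have hf : ((k - (j : ℕ))! : ℝ) ≠ 0 := by positivity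
    rw [← mul_right_inj' hf, ← hy, ← h, Finset.mul_sum]
    change _ = ∑ i, V j.rev i * V⁻¹.mulVec y i
    refine Finset.sum_congr rfl fun i _ => ?_
    have hVi : V j.rev i = (i : ℝ) ^ (k - (j : ℕ)) := by
      simp only [V, v, Matrix.transpose_apply, Matrix.vandermonde_apply, hj]
    rw [hVi, moment]
    field_simp

theorem moment_mul (r y : ℝ) (j : Fin (k + 1)) :
    moment k (r * y) j = r ^ (k - (j : ℕ)) * moment k y j := by
  unfold moment
  rw [mul_pow, mul_div_assoc]

/-- Expand `z` in moments at the nodes `i`, then rescale nodes and coefficients by `r`. Coordinate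
`j` gains `r * r^(k-j)`, and the cost of the path is linear in `r`. -/
theorem exists_edist_mul_vert_le (k : ℕ) (B : ℝ) : ∃ C : ℝ, 0 ≤ C ∧
    ∀ (p : JetSpace k) (w z : Fin (k + 1) → ℝ) (r : ℝ), 0 ≤ r → (∀ j, |z j| ≤ B) →
      (∀ j, w j = r ^ (k + 1 - (j : ℕ)) * z j) →
        edist p (p * vert w) ≤ ENNReal.ofReal (C * r) := by
  obtain ⟨D, hD, H⟩ := exists_sum_moment_eq k
  refine ⟨∑ i : Fin (k + 1), (2 * ((i : ℕ) : ℝ) + D * |B|), by positivity,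
    fun p w z r hr hz hw => ?_⟩
  obtain ⟨a, ha, ha'⟩ := H z B hz
  have e : w = ∑ i : Fin (k + 1), (r * a i) • moment k (r * (i : ℕ)) := by
    funext j
    have hj : k + 1 - (j : ℕ) = (k - j) + 1 := by omega
    rw [hw, ← ha', Finset.sum_apply, Finset.mul_sum]
    refine Finset.sum_congr rfl fun i _ => ?_
    rw [Pi.smul_apply, smul_eq_mul, moment_mul, hj]
    ring
  rw [e]
  refine (edist_mul_vert_sum_le _ _ _ p).trans (ENNReal.ofReal_le_ofReal ?_)
  rw [Finset.sum_mul]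
  refine Finset.sum_le_sum fun i _ => ?_
  rw [abs_mul, abs_mul, abs_of_nonneg hr, Nat.abs_cast]
  have : |a i| ≤ D * |B| := (ha i).trans (by gcongr; exact le_abs_self B)
  nlinarith

/-! ### Lower bounds for the distance. -/

/-- Let `e_j` be the deviation of `u_j` from the Taylor transport of the starting point. The contact
equations give `e_j' = e_{j+1} x'` almost everywhere and `e_k' = u_k'`, so each integration, from `j
= k` downwards, gains a factor `ε`. -/
theorem abs_le_pow_of_joins {γ : ℝ → JetSpace k} {a b ε : ℝ} {p q : JetSpace k} (hε : 0 ≤ ε)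
    (hJ : Joins γ a b p q) (hL : curveLength γ a b ≤ ENNReal.ofReal ε) (j : Fin (k + 1)) :
    ∀ τ ∈ Icc a b, |(γ τ).u j - shift ((γ τ).x - p.x) p.u j| ≤ ε ^ (k + 1 - (j : ℕ)) := by
  have hxac := hJ.horizontal.ac_x.fun_sub (ac_const p.x a b)
  have h0 : ∀ j, (γ a).u j - shift ((γ a).x - p.x) p.u j = 0 := by
    intro j
    rw [hJ.left, sub_self, shift_zero, sub_self]
  have key : ∀ (j : Fin (k + 1)) (n : ℕ),
      (∀ᵐ σ ∂(volume.restrict (Icc a b)),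
        |deriv (fun τ => (γ τ).u j - shift ((γ τ).x - p.x) p.u j) σ| ≤ ε ^ n * speed γ σ) →
      ∀ τ ∈ Icc a b, |(γ τ).u j - shift ((γ τ).x - p.x) p.u j| ≤ ε ^ (n + 1) := by
    intro j n h τ hτ
    have := abs_sub_le_of_deriv_le (γ := γ) (pow_nonneg hε n) hε
      ((hJ.horizontal.ac_u j).fun_sub (ac_shift hxac p.u j)) hτ (h.mono fun σ hσ _ => hσ) hL
    rwa [h0 j, sub_zero, ← pow_succ] at this
  induction j using Fin.reverseInduction with
  | last =>
    have hk : k + 1 - ((Fin.last k : Fin (k + 1)) : ℕ) = 0 + 1 := by simp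
    rw [hk]
    refine key _ 0 (Filter.Eventually.of_forall fun σ => ?_)
    simp_rw [shift_last]
    rw [deriv_sub_const, pow_zero, one_mul]
    exact abs_deriv_u_le_speed γ σ
  | cast i ih =>
    have hi : k + 1 - ((i.castSucc : Fin (k + 1)) : ℕ) = (k + 1 - ((i.succ : Fin (k + 1)) : ℕ)) + 1 := by
      rw [Fin.val_castSucc, Fin.val_succ]; omega
    rw [hi]
    refine key _ _ ?_
    have d1 := ae_restrict_of_ae (s := Icc a b) hJ.horizontal.ac_x.ae_differentiableAt
    have d2 := ae_restrict_of_ae (s := Icc a b) (hJ.horizontal.ac_u i.castSucc).ae_differentiableAt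
    filter_upwards [hJ.horizontal.contact, d1, d2, ae_restrict_mem measurableSet_Icc]
      with σ hσ h1 h2 hm
    have hm' : σ ∈ uIcc a b := Icc_subset_uIcc hm
    have hx := (h1 hm').hasDerivAt
    have hd := (h2 hm').hasDerivAt.fun_sub
      ((hasDerivAt_shift ((γ σ).x - p.x) p.u i).comp σ (hx.sub_const p.x))
    have hd' := hd.deriv
    simp only [Function.comp_apply] at hd'
    rw [hd', hσ i, ← sub_mul, abs_mul]
    exact mul_le_mul (ih σ hm) (abs_deriv_x_le_speed γ σ) (abs_nonneg _) (by positivity)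

theorem abs_le_of_edist_lt {p : JetSpace k} {w : Fin (k + 1) → ℝ} {ε : ℝ} (hε : 0 ≤ ε)
    (h : edist p (p * vert w) < ENNReal.ofReal ε) (j : Fin (k + 1)) :
    |w j| ≤ ε ^ (k + 1 - (j : ℕ)) := by
  obtain ⟨γ, a, b, hJ, hL⟩ := exists_of_ccEDist_lt h
  have := abs_le_pow_of_joins hε hJ hL.le j b (right_mem_Icc.2 hJ.le)
  rwa [hJ.right, mul_vert_x, mul_vert_u, sub_self, shift_zero, add_sub_cancel_left] at this

theorem ofReal_abs_le_edist_pow (p : JetSpace k) (w : Fin (k + 1) → ℝ) (j : Fin (k + 1)) :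
    ENNReal.ofReal |w j| ≤ edist p (p * vert w) ^ (k + 1 - (j : ℕ)) := by
  have hn : k + 1 - (j : ℕ) ≠ 0 := by omega
  rcases eq_or_ne (edist p (p * vert w)) ∞ with h | h
  · rw [h, ENNReal.top_pow hn]
    exact le_top
  lift edist p (p * vert w) to NNReal using h with d hd
  have hw : |w j| ≤ (d : ℝ) ^ (k + 1 - (j : ℕ)) := by
    -- No minimising curve is at hand, so the bound is taken for each `ε > d` and passed to the
    -- limit.
    refine ge_of_tendsto (x := nhdsWithin (d : ℝ) (Ioi (d : ℝ)))
      (((continuous_pow (k + 1 - (j : ℕ))).tendsto (d : ℝ)).mono_left nhdsWithin_le_nhds) ?_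
    filter_upwards [self_mem_nhdsWithin] with ε hε
    have hε' : (d : ℝ) < ε := hε
    refine abs_le_of_edist_lt (p := p) (d.coe_nonneg.trans hε'.le) ?_ j
    rw [← hd, ← ENNReal.ofReal_coe_nnreal]
    exact (ENNReal.ofReal_lt_ofReal_iff (d.coe_nonneg.trans_lt hε')).2 hε'
  refine (ENNReal.ofReal_le_ofReal hw).trans_eq ?_
  rw [ENNReal.ofReal_pow d.coe_nonneg, ENNReal.ofReal_coe_nnreal]

/-! ### Dimension of subsets of vertical lines. -/

theorem mul_vert_smul_eq (g : JetSpace k) (w : Fin (k + 1) → ℝ) (s s' : ℝ) :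
    g * vert (s' • w) = g * vert (s • w) * vert ((s' - s) • w) := by
  rw [mul_assoc, vert_mul_vert, ← add_smul, add_sub_cancel]

theorem dimH_image_mul_vert_le (g : JetSpace k) (w : Fin (k + 1) → ℝ) {K : Set ℝ}
    (hK : K ⊆ Icc 0 1) :
    dimH ((fun s : ℝ => g * vert (s • w)) '' K) ≤ dimH K * (k + 1) := by
  obtain ⟨C, hC, H⟩ := exists_edist_mul_vert_le k (∑ j, |w j|)
  have key : dimH ((fun s : ℝ => g * vert (s • w)) '' K) ≤
      dimH (id '' K) / ((k + 1 : NNReal)⁻¹ : NNReal) := by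
    refine dimH_image_le_of_edist_le (C := C.toNNReal) (by positivity) fun s hs s' hs' => ?_
    simp only [id]
    have h1 : |s' - s| ≤ 1 := by
      rw [abs_le]
      constructor <;> linarith [(hK hs).1, (hK hs).2, (hK hs').1, (hK hs').2]
    have hr0 : 0 ≤ |s' - s| ^ ((k : ℝ) + 1)⁻¹ := by positivity
    have hr1 : |s' - s| ^ ((k : ℝ) + 1)⁻¹ ≤ 1 :=
      Real.rpow_le_one (abs_nonneg _) h1 (by positivity)
    have hrk : (|s' - s| ^ ((k : ℝ) + 1)⁻¹) ^ (k + 1) = |s' - s| := by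
      have := Real.rpow_inv_natCast_pow (abs_nonneg (s' - s)) (Nat.succ_ne_zero k)
      push_cast at this
      exact this
    rw [edist_comm s s', edist_dist s', Real.dist_eq, ENNReal.ofReal_rpow_of_nonneg (abs_nonneg _)
      (NNReal.coe_nonneg _), ← ENNReal.ofReal, ← ENNReal.ofReal_mul hC, mul_vert_smul_eq g w s s']
    push_cast
    set r := |s' - s| ^ ((k : ℝ) + 1)⁻¹ with hr
    -- With `r^(k+1) = |s' - s|`, coordinate `j` of the displacement is `± r^(k+1-j) * (r^j * w j)`;
    -- the bracket stays bounded because `K ⊆ [0, 1]` gives `r ≤ 1`.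
    refine H _ _ (fun j => SignType.sign (s' - s) * (r ^ (j : ℕ) * w j)) r hr0 (fun j => ?_)
      (fun j => ?_)
    · rw [abs_mul, abs_mul, abs_of_nonneg (pow_nonneg hr0 _)]
      have a1 : |((SignType.sign (s' - s) : SignType) : ℝ)| ≤ 1 := by
        rcases lt_trichotomy (s' - s) 0 with h | h | h <;> simp [h]
      have a2 : r ^ (j : ℕ) ≤ 1 := pow_le_one₀ hr0 hr1
      have a3 : |w j| ≤ ∑ j, |w j| :=
        Finset.single_le_sum (f := fun j => |w j|) (fun _ _ => abs_nonneg _) (Finset.mem_univ j)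
      calc _ ≤ 1 * (1 * |w j|) := by gcongr
        _ ≤ _ := by simpa using a3
    · have hp : r ^ (k + 1 - (j : ℕ)) * r ^ (j : ℕ) = |s' - s| := by
        rw [← pow_add, Nat.sub_add_cancel j.2.le, hrk]
      rw [Pi.smul_apply, smul_eq_mul, mul_left_comm, ← mul_assoc (r ^ _), hp, ← mul_assoc,
        sign_mul_abs]
  rw [image_id] at key
  refine key.trans_eq ?_
  rw [ENNReal.div_eq_inv_mul, ENNReal.coe_inv (by positivity), inv_inv, mul_comm]
  simp

/-- The coordinate `u_0` has the top weight `k + 1`, so it recovers the parameter as a `(k +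
1)`-Hölder function of the point. -/
theorem le_dimH_image_mul_vert (g : JetSpace k) {w : Fin (k + 1) → ℝ} (hw : w 0 ≠ 0) (K : Set ℝ) :
    dimH K * (k + 1) ≤ dimH ((fun s : ℝ => g * vert (s • w)) '' K) := by
  have key : dimH (id '' K) ≤ dimH ((fun s : ℝ => g * vert (s • w)) '' K) / (k + 1 : NNReal) := by
    refine dimH_image_le_of_edist_le (C := |w 0|⁻¹.toNNReal) (by positivity)
      fun s _ s' _ => ?_
    have h := ofReal_abs_le_edist_pow (g * vert (s • w)) ((s' - s) • w) 0
    rw [← mul_vert_smul_eq, Pi.smul_apply, smul_eq_mul, abs_mul] at h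
    simp only [id]
    rw [edist_comm s s', edist_dist s', Real.dist_eq]
    have e : |s' - s| = |w 0|⁻¹ * (|s' - s| * |w 0|) := by
      have : |w 0| ≠ 0 := abs_ne_zero.2 hw
      field_simp
    rw [e, ENNReal.ofReal_mul (by positivity), ← ENNReal.ofReal]
    refine mul_le_mul' le_rfl (h.trans_eq ?_)
    rw [← ENNReal.rpow_natCast]
    simp
  rw [image_id, ENNReal.le_div_iff_mul_le (by simp) (by simp)] at key
  simpa using key

/-! ### The fibre lines and their images. -/

/-- The vertical line over `c` in the direction of `∂/∂u_k`. -/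
noncomputable def vertLine (k : ℕ) (c s : ℝ) : JetSpace k :=
  ⟨c, 0⟩ * vert (Pi.single (Fin.last k) s)

/-- The direction is horizontal, which bounds the distance above; `u_k` has weight `1`, which bounds
it below. -/
theorem isometry_vertLine (k : ℕ) (c : ℝ) : Isometry (vertLine k c) := by
  intro s s'
  have e : vertLine k c s' = vertLine k c s * vert (Pi.single (Fin.last k) (s' - s)) := by
    rw [vertLine, vertLine, mul_assoc, vert_mul_vert, ← Pi.single_add, add_sub_cancel]
  rw [e, edist_comm s s', edist_dist s', Real.dist_eq]
  refine le_antisymm (edist_mul_vert_single_le _ _) ?_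
  have := ofReal_abs_le_edist_pow (vertLine k c s) (Pi.single (Fin.last k) (s' - s)) (Fin.last k)
  simpa using this

theorem verticalMap_vertLine (f : ℝ → ℝ) (t c s : ℝ) :
    verticalMap f t (vertLine k c s) =
      ⟨c, 0⟩ * (jet k f (c - t))⁻¹ * vert (s • moment k (t - c)) := by
  have hx : (vertLine k c s).x = c := mul_vert_x _ _
  have hy : ((jet k f (c - t))⁻¹).x = t - c := by
    rw [inv_x]
    exact neg_sub c t
  rw [verticalMap, hx, vertLine, mul_assoc, vert_mul, hy, shift_single, mul_assoc]

theorem image_verticalMap_vertLine (f : ℝ → ℝ) (t c : ℝ) (K : Set ℝ) :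
    verticalMap f t '' (vertLine k c '' K) =
      (fun s : ℝ => ⟨c, 0⟩ * (jet k f (c - t))⁻¹ * vert (s • moment k (t - c))) '' K := by
  rw [image_image]
  simp_rw [verticalMap_vertLine]

theorem dimH_verticalMap_vertLine_le (f : ℝ → ℝ) (t c : ℝ) {K : Set ℝ} (hK : K ⊆ Icc 0 1) :
    dimH (verticalMap f t '' (vertLine k c '' K)) ≤ dimH K * (k + 1) := by
  rw [image_verticalMap_vertLine]
  exact dimH_image_mul_vert_le _ _ hK

theorem le_dimH_verticalMap_vertLine (f : ℝ → ℝ) {t c : ℝ} (h : t ≠ c) (K : Set ℝ) :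
    dimH K * (k + 1) ≤ dimH (verticalMap f t '' (vertLine k c '' K)) := by
  rw [image_verticalMap_vertLine]
  refine le_dimH_image_mul_vert _ ?_ K
  exact div_ne_zero (pow_ne_zero _ (sub_ne_zero.2 h)) (by positivity)

end JetSpace

open JetSpace in
theorem mainTheorem10 (k : ℕ) (hk : 1 ≤ k) (m b : ℝ) (hm : m ≠ 0) (μ : ℝ) (hμ₀ : 0 ≤ μ)
    (hμ₁ : μ ≤ 1) :
    ∃ E : Set (JetSpace k), MeasurableSet[borel (JetSpace k)] E ∧ dimH E = ENNReal.ofReal μ ∧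
      ∀ t : ℝ, dimH (JetSpace.verticalMap (fun x => m * x + b) t '' E) =
        ENNReal.ofReal ((k + 1) * μ) := by
  obtain ⟨K, hKc, hK, hd⟩ := exists_isCompact_dimH_eq hμ₀ hμ₁
  have hE : IsCompact (vertLine k 0 '' K ∪ vertLine k 1 '' K) :=
    (hKc.image (isometry_vertLine k 0).continuous).union
      (hKc.image (isometry_vertLine k 1).continuous)
  refine ⟨vertLine k 0 '' K ∪ vertLine k 1 '' K, ?_, ?_, fun t => ?_⟩
  · borelize (JetSpace k)
    exact hE.isClosed.measurableSet
  · rw [dimH_union, (isometry_vertLine k 0).dimH_image, (isometry_vertLine k 1).dimH_image, max_self,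
      hd]
  · have e : ENNReal.ofReal ((k + 1) * μ) = dimH K * (k + 1) := by
      rw [hd, mul_comm, ENNReal.ofReal_mul hμ₀, ENNReal.ofReal_add (by positivity) zero_le_one]
      simp
    rw [image_union, dimH_union, e]
    refine le_antisymm (max_le (dimH_verticalMap_vertLine_le _ t 0 hK)
      (dimH_verticalMap_vertLine_le _ t 1 hK)) ?_
    -- The fibre over `0` serves every `t` except `0`, and for `t = 0` the fibre over `1` does.
    rcases ne_or_eq t 0 with h | rfl
    · exact le_max_of_le_left (le_dimH_verticalMap_vertLine _ h K)
    · exact le_max_of_le_right (le_dimH_verticalMap_vertLine _ zero_ne_one K)
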